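/- Let $d\ge 1$, let $\mathbb S^{d-1}=\{x\in\mathbb R^d:\|x\|=1\}$ be the unit sphere with the round metric, let $c>0$ and $0<\alpha<\frac1{2+c}$, and define the spherical logarithmic kernel $$k_{c,\alpha}(x,y):=-\log\bigl(\alpha(1-x^\top y+c)\bigr),\qquad x,y\in\mathbb S^{d-1}.$$ Then: (i) $k_{c,\alpha}(x,y)>0$ for all $x,y\in\mathbb S^{d-1}$; (ii) $k_{c,\alpha}$ is $C^\infty$ on $\mathbb S^{d-1}\times\mathbb S^{d-1}$; (iii) the Riemannian gradient in the first variable satisfies $\|\nabla_{\mathbb S,x}k_{c,\alpha}(x,y)\|\le \frac1c$ for all $x,y\in\mathbb S^{d-1}$; (iv) $k_{c,\alpha}$ is characteristic: it is symmetric and positive definite (all its Gram matrices are positive semidefinite), and the kernel mean embedding $\mu\mapsto\int k_{c,\alpha}(\cdot,y)\,d\mu(y)$, with values in the reproducing kernel Hilbert space of $k_{c,\alpha}$, is well defined and injective on the Borel probability measures on $\mathbb S^{d-1}$; (v) for all $x,y\in\mathbb S^{d-1}$, $k_{c,\alpha}(x,y)=\sum_{m=0}^\infty a_m (x^\top y)^m$,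 where $a_0=-\log(\alpha(1+c))$ and $a_m=\frac{1}{m(1+c)^m}$ for $m\ge1$, and $a_m>0$ for every $m\ge0$. -/

import Mathlib

open scoped ContDiff Manifold InnerProductSpace

noncomputable section

namespace SphericalLog

/-- The unit sphere of the Euclidean space `ℝ ^ (n + 1)`, an `n`-dimensional manifold. -/
abbrev Sph (n : ℕ) : Type := Metric.sphere (0 : EuclideanSpace ℝ (Fin (n + 1))) 1

/-- The differential at `x` of the inclusion of the sphere in the ambient Euclidean space. -/
def incl {n : ℕ} (x : Sph n) :
    TangentSpace (𝓡 n) x →L[ℝ] EuclideanSpace ℝ (Fin (n + 1)) :=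
  mvfderiv (𝓡 n) ((↑) : Sph n → EuclideanSpace ℝ (Fin (n + 1))) x

/-- The round Riemannian metric: the pullback of the Euclidean inner product
to the tangent space of the sphere at `x`. -/
def roundMetric {n : ℕ} (x : Sph n) : LinearMap.BilinForm ℝ (TangentSpace (𝓡 n) x) :=
  LinearMap.mk₂ ℝ (fun v w => ⟪incl x v, incl x w⟫_ℝ)
    (fun v₁ v₂ w => by rw [map_add, inner_add_left])
    (fun r v w => by rw [map_smul, real_inner_smul_left, smul_eq_mul])
    (fun v w₁ w₂ => by rw [map_add, inner_add_right])
    (fun r v w => by rw [map_smul, real_inner_smul_right, smul_eq_mul])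

theorem roundMetric_apply {n : ℕ} (x : Sph n) (v w : TangentSpace (𝓡 n) x) :
    roundMetric x v w = ⟪incl x v, incl x w⟫_ℝ := rfl

theorem incl_injective {n : ℕ} (x : Sph n) : Function.Injective (incl x) :=
  haveI := Fact.mk (@finrank_euclideanSpace_fin ℝ _ (n + 1))
  injective_mvfderiv_subtypeVal_sphere x

theorem roundMetric_self_eq_zero {n : ℕ} (x : Sph n) (v : TangentSpace (𝓡 n) x)
    (h : roundMetric x v v = 0) : v = 0 := by
  rw [roundMetric_apply, inner_self_eq_zero] at h
  exact incl_injective x (h.trans (map_zero _).symm)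

theorem roundMetric_nondegenerate {n : ℕ} (x : Sph n) : (roundMetric x).Nondegenerate :=
  ⟨fun v h => roundMetric_self_eq_zero x v (h v),
    fun v h => roundMetric_self_eq_zero x v (h v)⟩

instance {n : ℕ} (x : Sph n) : FiniteDimensional ℝ (TangentSpace (𝓡 n) x) :=
  inferInstanceAs (FiniteDimensional ℝ (EuclideanSpace ℝ (Fin n)))

/-- The Riemannian gradient at `x` of a function on the sphere with the round metric: the tangent
vector that represents the differential of `f` at `x` with respect to the metric. -/
def sphereGrad {n : ℕ} (f : Sph n → ℝ) (x : Sph n) : TangentSpace (𝓡 n) x :=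
  (LinearMap.BilinForm.toDual (roundMetric x) (roundMetric_nondegenerate x)).symm
    (mvfderiv (𝓡 n) f x : TangentSpace (𝓡 n) x →L[ℝ] ℝ).toLinearMap

/-- The Riemannian norm of a tangent vector for the round metric. -/
def roundNorm {n : ℕ} (x : Sph n) (v : TangentSpace (𝓡 n) x) : ℝ :=
  Real.sqrt (roundMetric x v v)

/-- A scalar kernel as an operator-valued one: the entry at `(x, y)` is multiplication
by `k x y`. -/
def kernelMatrix {X : Type*} (k : X → X → ℝ) : Matrix X X (ℝ →L[ℝ] ℝ) :=
  Matrix.of fun x y => k x y • ContinuousLinearMap.id ℝ ℝ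

/-- For a (symmetric) positive definite kernel `k`, with `RKHS.OfKernel (kernelMatrix k)` its
reproducing kernel Hilbert space, the canonical feature map `y ↦ k(·, y)`. -/
def feature {X : Type*} (k : X → X → ℝ) [Fact (kernelMatrix k).PosSemidef] (y : X) :
    RKHS.OfKernel (kernelMatrix k) :=
  RKHS.kerFun (RKHS.OfKernel (kernelMatrix k)) y 1

theorem feature_apply {X : Type*} (k : X → X → ℝ) [Fact (kernelMatrix k).PosSemidef]
    (x y : X) : feature k y x = k x y := by
  rw [feature, RKHS.kerFun_apply, RKHS.OfKernel.kernel_ofKernel]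
  simp [kernelMatrix]

/-- The kernel mean embedding `∫ k(·, y) dμ(y)`, as an element of the reproducing kernel Hilbert
space of `k` (a Bochner integral). -/
def meanEmbedding {X : Type*} [MeasurableSpace X] (k : X → X → ℝ)
    [Fact (kernelMatrix k).PosSemidef] (μ : MeasureTheory.ProbabilityMeasure X) :
    RKHS.OfKernel (kernelMatrix k) :=
  ∫ y, feature k y ∂(μ : MeasureTheory.Measure X)

/-- A kernel is characteristic if it is symmetric and positive definite (in the sense of kernels:
all its Gram matrices are positive semidefinite), every probability measure has a mean embedding
in its reproducing kernel Hilbert space, and the mean embedding is injective on probability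
measures. -/
def IsCharacteristic {X : Type*} [MeasurableSpace X] (k : X → X → ℝ) : Prop :=
  ∃ h : (kernelMatrix k).PosSemidef,
    haveI : Fact (kernelMatrix k).PosSemidef := ⟨h⟩
    (∀ μ : MeasureTheory.ProbabilityMeasure X,
      MeasureTheory.Integrable (feature k) (μ : MeasureTheory.Measure X)) ∧
    Function.Injective
      (meanEmbedding k : MeasureTheory.ProbabilityMeasure X → RKHS.OfKernel (kernelMatrix k))

/-- The spherical logarithmic kernel `-log (α (1 - x · y + c))`. -/
def logKernel (n : ℕ) (c α : ℝ) (x y : Sph n) : ℝ :=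
  -Real.log (α * (1 - ⟪(x : EuclideanSpace ℝ (Fin (n + 1))), y⟫_ℝ + c))

end SphericalLog

end

/-!
The kernel depends on `x` and `y` only through `t = x · y ∈ [-1, 1]`, where `α (1 - t + c)` lies
between `α c > 0` and `α (2 + c) < 1`; this gives positivity, and smoothness by composition. The
ambient gradient of the kernel in `x` is `y / (1 - t + c)`, of norm at most `1 / c`, and the
Riemannian gradient, its tangential component, is no longer (`roundNorm_sphereGrad_le`). The power
series comes from `-log (α (1 - t + c)) = -log (α (1 + c)) - log (1 - t / (1 + c))`.

For the last property, `(x · y) ^ m` is the inner product of the tensor powers of `x` and `y`, whose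
components are monomials (`inner_pow_eq_sum_sphMonomial`). Hence every quadratic form of the kernel
is a series of sums of squares with positive coefficients, which makes the kernel positive
definite. The same computation with measures in place of finite combinations of points expresses
the energy `∬ k d(μ - ν) d(μ - ν)` as a series, with positive coefficients, of squares of
differences of moments of `μ` and `ν`. If the mean embeddings of `μ` and `ν` agree, the energy is
zero, so all moments agree (`integral_sphMonomial_eq`), and `μ = ν` because polynomials are dense in
the continuous functions on the sphere (`measure_eq_of_integral_sphMonomial_eq`). Mean embeddings
exist as Bochner integrals since the feature map of a continuous kernel is continuous and the
sphere is compact (`integrable_feature`).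
-/

open MeasureTheory

namespace SphericalLog

variable {n : ℕ} {c α : ℝ}

/-! ### The kernel as a function of the inner product -/

theorem abs_inner_le_one (x y : Sph n) :
    |⟪(x : EuclideanSpace ℝ (Fin (n + 1))), y⟫_ℝ| ≤ 1 := by
  have h := abs_real_inner_le_norm (x : EuclideanSpace ℝ (Fin (n + 1))) y
  rwa [norm_eq_of_mem_sphere, norm_eq_of_mem_sphere, one_mul] at h

theorem le_one_sub_inner_add (x y : Sph n) :
    c ≤ 1 - ⟪(x : EuclideanSpace ℝ (Fin (n + 1))), y⟫_ℝ + c := by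
  have h := (abs_le.1 (abs_inner_le_one x y)).2
  linarith

theorem logKernel_pos (hc : 0 < c) (hα : 0 < α) (hαc : α < 1 / (2 + c)) (x y : Sph n) :
    0 < logKernel n c α x y := by
  have h1 := le_one_sub_inner_add (c := c) x y
  have h2 := (abs_le.1 (abs_inner_le_one x y)).1
  rw [lt_div_iff₀ (by linarith)] at hαc
  refine neg_pos.2 (Real.log_neg (mul_pos hα (hc.trans_le h1)) (lt_of_le_of_lt ?_ hαc))
  exact mul_le_mul_of_nonneg_left (by linarith) hα.le

theorem logKernel_comm (x y : Sph n) : logKernel n c α x y = logKernel n c α y x := by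
  rw [logKernel, logKernel, real_inner_comm]

theorem contMDiff_logKernel (hc : 0 < c) (hα : 0 < α) :
    ContMDiff ((𝓡 n).prod (𝓡 n)) 𝓘(ℝ) ∞ (fun p : Sph n × Sph n => logKernel n c α p.1 p.2) := by
  have := Fact.mk (@finrank_euclideanSpace_fin ℝ _ (n + 1))
  have hcoe : ContMDiff (𝓡 n) 𝓘(ℝ, EuclideanSpace ℝ (Fin (n + 1))) ∞
      ((↑) : Sph n → EuclideanSpace ℝ (Fin (n + 1))) := contMDiff_coe_sphere
  have hpair := (hcoe.comp contMDiff_fst).prodMk_space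
    (hcoe.comp (contMDiff_snd (I := 𝓡 n) (M := Sph n)))
  intro p
  have hpos := hc.trans_le (le_one_sub_inner_add (c := c) p.1 p.2)
  have hG : ContDiffAt ℝ ∞
      (fun q : EuclideanSpace ℝ (Fin (n + 1)) × EuclideanSpace ℝ (Fin (n + 1)) =>
        -Real.log (α * (1 - ⟪q.1, q.2⟫_ℝ + c))) (p.1, p.2) := by
    refine ContDiffAt.neg (ContDiffAt.log ?_ (mul_pos hα hpos).ne')
    exact contDiffAt_const.mul ((contDiffAt_const.sub
      (contDiffAt_fst.inner ℝ contDiffAt_snd)).add contDiffAt_const)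
  exact hG.comp_contMDiffAt (f := fun p : Sph n × Sph n =>
    ((p.1 : EuclideanSpace ℝ (Fin (n + 1))), (p.2 : EuclideanSpace ℝ (Fin (n + 1))))) (hpair p)

theorem continuous_logKernel (hc : 0 < c) (hα : 0 < α) :
    Continuous fun p : Sph n × Sph n => logKernel n c α p.1 p.2 :=
  (contMDiff_logKernel hc hα).continuous

/-! ### The Riemannian gradient -/

theorem roundNorm_eq_norm_incl (x : Sph n) (v : TangentSpace (𝓡 n) x) :
    roundNorm x v = ‖incl x v‖ := by
  rw [roundNorm, roundMetric_apply, real_inner_self_eq_norm_sq, Real.sqrt_sq (norm_nonneg _)]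

/-- The Riemannian gradient is no longer than any ambient vector representing the differential:
it corresponds to the tangential component of such a vector. -/
theorem roundNorm_sphereGrad_le {f : Sph n → ℝ} {x : Sph n}
    {w : EuclideanSpace ℝ (Fin (n + 1))}
    (h : ∀ v : TangentSpace (𝓡 n) x, mvfderiv (𝓡 n) f x v = ⟪w, incl x v⟫_ℝ) :
    roundNorm x (sphereGrad f x) ≤ ‖w‖ := by
  have hg : roundMetric x (sphereGrad f x) (sphereGrad f x)
      = ⟪w, incl x (sphereGrad f x)⟫_ℝ :=
    (LinearMap.BilinForm.apply_toDual_symm_apply _ _).trans (h _)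
  rw [roundMetric_apply, real_inner_self_eq_norm_sq] at hg
  rw [roundNorm_eq_norm_incl]
  have hle := real_inner_le_norm w (incl x (sphereGrad f x))
  rw [← hg, sq] at hle
  -- Now `‖grad‖ * ‖grad‖ ≤ ‖w‖ * ‖grad‖`, and the factor `‖grad‖` cancels unless it is zero.
  rcases (norm_nonneg (incl x (sphereGrad f x))).eq_or_lt with h0 | h0
  · rw [← h0]
    exact norm_nonneg w
  · exact le_of_mul_le_mul_right hle h0

/-- The chain rule for the restriction to the sphere of a function with ambient gradient `w`. -/
theorem mvfderiv_comp_coe_sphere {F : EuclideanSpace ℝ (Fin (n + 1)) → ℝ} {x : Sph n}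
    {w : EuclideanSpace ℝ (Fin (n + 1))}
    (hF : HasFDerivAt F (innerSL ℝ w) (x : EuclideanSpace ℝ (Fin (n + 1))))
    (v : TangentSpace (𝓡 n) x) :
    mvfderiv (𝓡 n) (fun z : Sph n => F z) x v = ⟪w, incl x v⟫_ℝ := by
  have := Fact.mk (@finrank_euclideanSpace_fin ℝ _ (n + 1))
  have hcoe : MDifferentiableAt (𝓡 n) 𝓘(ℝ, EuclideanSpace ℝ (Fin (n + 1)))
      ((↑) : Sph n → EuclideanSpace ℝ (Fin (n + 1))) x :=
    (contMDiff_coe_sphere x).mdifferentiableAt one_ne_zero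
  refine (mvfderiv_comp_apply x hF.differentiableAt.mdifferentiableAt hcoe v).trans ?_
  rw [mvfderiv, mfderiv_eq_fderiv, hF.fderiv]
  rfl

theorem roundNorm_sphereGrad_logKernel_le (hc : 0 < c) (hα : 0 < α) (x y : Sph n) :
    roundNorm x (sphereGrad (fun z => logKernel n c α z y) x) ≤ 1 / c := by
  have hle := le_one_sub_inner_add (c := c) x y
  have hpos := hc.trans_le hle
  set s := 1 - ⟪(x : EuclideanSpace ℝ (Fin (n + 1))), y⟫_ℝ + c with hs
  have hF : HasFDerivAt (fun z : EuclideanSpace ℝ (Fin (n + 1)) =>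
      -Real.log (α * (1 - ⟪z, (y : EuclideanSpace ℝ (Fin (n + 1)))⟫_ℝ + c)))
      (innerSL ℝ (s⁻¹ • (y : EuclideanSpace ℝ (Fin (n + 1)))))
      (x : EuclideanSpace ℝ (Fin (n + 1))) := by
    have h1 : HasFDerivAt (fun z : EuclideanSpace ℝ (Fin (n + 1)) =>
        ⟪z, (y : EuclideanSpace ℝ (Fin (n + 1)))⟫_ℝ)
        (innerSL ℝ (y : EuclideanSpace ℝ (Fin (n + 1))))
        (x : EuclideanSpace ℝ (Fin (n + 1))) := by
      refine (innerSL ℝ (y : EuclideanSpace ℝ (Fin (n + 1)))).hasFDerivAt.congr_of_eventuallyEq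
        (Filter.Eventually.of_forall fun z => ?_)
      exact real_inner_comm _ _
    have h2 := ((((h1.const_sub 1).add_const c).const_mul α).log (mul_pos hα hpos).ne').neg
    convert! h2 using 1
    rw [← hs]
    ext v
    simp
    field_simp
  refine (roundNorm_sphereGrad_le (mvfderiv_comp_coe_sphere hF)).trans ?_
  rw [norm_smul, norm_eq_of_mem_sphere, mul_one, norm_inv, Real.norm_of_nonneg hpos.le, ← one_div]
  exact one_div_le_one_div_of_le hc hle

/-! ### The power series in the inner product -/

/-- The Taylor coefficients at `0` of `t ↦ -log (α (1 - t + c))`. -/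
noncomputable def logCoeff (c α : ℝ) : ℕ → ℝ
  | 0 => -Real.log (α * (1 + c))
  | m + 1 => 1 / ((m + 1 : ℕ) * (1 + c) ^ (m + 1))

theorem logCoeff_pos (hc : 0 < c) (hα : 0 < α) (hαc : α < 1 / (2 + c)) (m : ℕ) :
    0 < logCoeff c α m := by
  cases m with
  | zero =>
    rw [lt_div_iff₀ (by linarith)] at hαc
    exact neg_pos.2 (Real.log_neg (by positivity) (by nlinarith))
  | succ m => exact one_div_pos.2 (by positivity)

theorem hasSum_logCoeff_mul_pow (hc : 0 < c) (hα : 0 < α) {t : ℝ} (ht : |t| ≤ 1) :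
    HasSum (fun m => logCoeff c α m * t ^ m) (-Real.log (α * (1 - t + c))) := by
  have hc1 : 0 < 1 + c := by linarith
  have hlt : |t / (1 + c)| < 1 := by
    rw [abs_div, abs_of_pos hc1, div_lt_one hc1]
    linarith
  have h := Real.hasSum_pow_div_log_of_abs_lt_one hlt
  have hpos : 0 < 1 - t / (1 + c) := by
    have := (abs_lt.1 hlt).2
    linarith
  rw [← hasSum_nat_add_iff' 1]
  -- The logarithm series is applied to `t / (1 + c)`.
  have harg : α * (1 - t + c) = α * (1 + c) * (1 - t / (1 + c)) := by
    field_simp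
    ring
  convert! h using 1
  · funext m
    simp only [logCoeff]
    rw [div_pow]
    push_cast
    field_simp
  · rw [harg, Real.log_mul (by positivity) hpos.ne']
    simp [logCoeff]

theorem hasSum_logKernel (hc : 0 < c) (hα : 0 < α) (x y : Sph n) :
    HasSum (fun m => logCoeff c α m * ⟪(x : EuclideanSpace ℝ (Fin (n + 1))), y⟫_ℝ ^ m)
      (logKernel n c α x y) :=
  hasSum_logCoeff_mul_pow hc hα (abs_inner_le_one x y)

theorem summable_logCoeff (hc : 0 < c) (hα : 0 < α) : Summable (logCoeff c α) := by
  simpa using (hasSum_logCoeff_mul_pow (α := α) hc hα (t := 1) (by simp)).summable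

/-! ### Monomials on the sphere -/

/-- The restriction to the sphere of the monomial `∏ j, x (i j)` of degree `m`. Since the order of
the factors is recorded in `i`, these are the components of the tensor power `x ^ ⊗ m`. -/
noncomputable def sphMonomial {m : ℕ} (i : Fin m → Fin (n + 1)) (x : Sph n) : ℝ :=
  ∏ j, (x : EuclideanSpace ℝ (Fin (n + 1))) (i j)

/-- The inner product of the tensor powers of `x` and `y` is the power of their inner product. -/
theorem inner_pow_eq_sum_sphMonomial (m : ℕ) (x y : Sph n) :
    ⟪(x : EuclideanSpace ℝ (Fin (n + 1))), y⟫_ℝ ^ m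
      = ∑ i : Fin m → Fin (n + 1), sphMonomial i x * sphMonomial i y := by
  rw [PiLp.inner_apply, Fintype.sum_pow]
  refine Finset.sum_congr rfl fun i _ => ?_
  rw [sphMonomial, sphMonomial, ← Finset.prod_mul_distrib]
  exact Finset.prod_congr rfl fun j _ => mul_comm _ _

theorem continuous_sphMonomial {m : ℕ} (i : Fin m → Fin (n + 1)) :
    Continuous (sphMonomial i) := by
  unfold sphMonomial
  fun_prop

/-! ### Positive definiteness -/

theorem posSemidef_kernelMatrix_logKernel (hc : 0 < c) (hα : 0 < α) (hαc : α < 1 / (2 + c)) :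
    (kernelMatrix (logKernel n c α)).PosSemidef := by
  have hiff := (RKHS.posSemidef_tfae (K := kernelMatrix (logKernel n c α))).out 0 2
  refine hiff.2 ⟨?_, fun w => ?_⟩
  · have hid : star (ContinuousLinearMap.id ℝ ℝ) = ContinuousLinearMap.id ℝ ℝ := star_one _
    ext x y
    simp [kernelMatrix, logKernel_comm x y, hid]
  · -- Each power of the inner product contributes a sum of squares to the quadratic form at `w`.
    have h : HasSum (fun m => logCoeff c α m *
        ∑ i : Fin m → Fin (n + 1), (w.sum fun x r => r * sphMonomial i x) ^ 2)
        (w.sum fun x r => w.sum fun y s => ⟪kernelMatrix (logKernel n c α) y x r, s⟫_ℝ) := by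
      have h1 : HasSum (fun m => w.sum fun x r => w.sum fun y s =>
          r * s * (logCoeff c α m * ⟪(y : EuclideanSpace ℝ (Fin (n + 1))), x⟫_ℝ ^ m))
          (w.sum fun x r => w.sum fun y s => r * s * logKernel n c α y x) :=
        hasSum_sum fun x _ => hasSum_sum fun y _ => (hasSum_logKernel hc hα y x).mul_left _
      convert! h1 using 1
      · funext m
        simp only [inner_pow_eq_sum_sphMonomial, sq, Finsupp.sum, Finset.mul_sum, Finset.sum_mul]
        rw [Finset.sum_comm]
        refine Finset.sum_congr rfl fun x _ => ?_
        rw [Finset.sum_comm]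
        refine Finset.sum_congr rfl fun y _ => Finset.sum_congr rfl fun i _ => ?_
        ring
      · simp only [Finsupp.sum]
        refine Finset.sum_congr rfl fun x _ => Finset.sum_congr rfl fun y _ => ?_
        simp [kernelMatrix]
        ring
    exact h.nonneg fun m => mul_nonneg (logCoeff_pos hc hα hαc m).le
      (Finset.sum_nonneg fun i _ => sq_nonneg _)

/-! ### The mean embedding -/

theorem inner_feature {X : Type*} (k : X → X → ℝ) [Fact (kernelMatrix k).PosSemidef]
    (x y : X) : ⟪feature k x, feature k y⟫_ℝ = k x y := by
  have h : ⟪feature k x, feature k y⟫_ℝ = ⟪(1 : ℝ), feature k y x⟫_ℝ := RKHS.kerFun_inner _ _ _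
  rw [h, feature_apply]
  simp

/-- A continuous kernel has a continuous feature map, since
`‖k(·, y) - k(·, x)‖² = k(y, y) - 2 k(y, x) + k(x, x)`. -/
theorem continuous_feature {X : Type*} [TopologicalSpace X] (k : X → X → ℝ)
    [Fact (kernelMatrix k).PosSemidef] (hk : Continuous fun p : X × X => k p.1 p.2) :
    Continuous (feature k) := by
  rw [continuous_iff_continuousAt]
  intro x
  rw [ContinuousAt, tendsto_iff_norm_sub_tendsto_zero]
  have hsq : ∀ y, ‖feature k y - feature k x‖ = √(k y y - 2 * k y x + k x x) := fun y => by
    rw [← Real.sqrt_sq (norm_nonneg _), norm_sub_sq_real, inner_feature,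
      ← real_inner_self_eq_norm_sq, ← real_inner_self_eq_norm_sq, inner_feature, inner_feature]
  simp only [hsq]
  have hcont : Continuous fun y => √(k y y - 2 * k y x + k x x) := by
    have h1 : Continuous fun y => k y y := hk.comp (continuous_id.prodMk continuous_id)
    have h2 : Continuous fun y => k y x := hk.comp (continuous_id.prodMk continuous_const)
    fun_prop
  have h := hcont.tendsto x
  have h0 : k x x - 2 * k x x + k x x = 0 := by ring
  rwa [h0, Real.sqrt_zero] at h

theorem integrable_feature {X : Type*} [TopologicalSpace X] [CompactSpace X]
    [SecondCountableTopology X] [MeasurableSpace X] [OpensMeasurableSpace X]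
    (k : X → X → ℝ) [Fact (kernelMatrix k).PosSemidef]
    (hk : Continuous fun p : X × X => k p.1 p.2) (μ : Measure X) [IsFiniteMeasure μ] :
    Integrable (feature k) μ := by
  have hcont := continuous_feature k hk
  obtain ⟨C, hC⟩ := (isCompact_range hcont).isBounded.exists_norm_le
  exact Integrable.of_bound hcont.aestronglyMeasurable C
    (Filter.Eventually.of_forall fun x => hC _ (Set.mem_range_self x))

theorem meanEmbedding_apply {X : Type*} [MeasurableSpace X] (k : X → X → ℝ)
    [Fact (kernelMatrix k).PosSemidef] (μ : ProbabilityMeasure X)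
    (hμ : Integrable (feature k) (μ : Measure X)) (x : X) :
    meanEmbedding k μ x = ∫ y, k x y ∂(μ : Measure X) := by
  have h : ∀ f : RKHS.OfKernel (kernelMatrix k), f x = ⟪feature k x, f⟫_ℝ := fun f => by
    have := RKHS.kerFun_inner x (1 : ℝ) f
    rw [feature, this]
    simp
  rw [h, meanEmbedding, ← integral_inner hμ]
  simp only [inner_feature]

/-! ### Injectivity of the mean embedding -/

theorem integrable_of_continuous {X : Type*} [TopologicalSpace X] [CompactSpace X]
    [MeasurableSpace X] [OpensMeasurableSpace X] {f : X → ℝ} (hf : Continuous f)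
    (μ : Measure X) [IsFiniteMeasure μ] : Integrable f μ :=
  (BoundedContinuousFunction.mkOfCompact ⟨f, hf⟩).integrable μ

/-- The mutual energy of two measures, expanded in their moments. -/
theorem hasSum_integral_integral_logKernel (hc : 0 < c) (hα : 0 < α) (hαc : α < 1 / (2 + c))
    (μ ν : Measure (Sph n)) [IsFiniteMeasure μ] [IsFiniteMeasure ν] :
    HasSum (fun m => logCoeff c α m * ∑ i : Fin m → Fin (n + 1),
        (∫ x, sphMonomial i x ∂μ) * ∫ y, sphMonomial i y ∂ν)
      (∫ x, ∫ y, logKernel n c α x y ∂ν ∂μ) := by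
  have hcont (m : ℕ) : Continuous fun p : Sph n × Sph n =>
      logCoeff c α m * ⟪(p.1 : EuclideanSpace ℝ (Fin (n + 1))), p.2⟫_ℝ ^ m := by
    fun_prop
  have h := hasSum_integral_of_dominated_convergence (μ := μ.prod ν)
    (F := fun m (p : Sph n × Sph n) =>
      logCoeff c α m * ⟪(p.1 : EuclideanSpace ℝ (Fin (n + 1))), p.2⟫_ℝ ^ m)
    (f := fun p => logKernel n c α p.1 p.2) (fun m _ => logCoeff c α m)
    (fun m => (hcont m).aestronglyMeasurable)
    (fun m => Filter.Eventually.of_forall fun p => ?_)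
    (Filter.Eventually.of_forall fun p => summable_logCoeff hc hα)
    (integrable_const _)
    (Filter.Eventually.of_forall fun p => hasSum_logKernel hc hα p.1 p.2)
  · convert! h using 1
    · funext m
      rw [integral_const_mul]
      simp only [inner_pow_eq_sum_sphMonomial]
      rw [integral_finsetSum]
      · simp only [integral_prod_mul]
      · exact fun i _ => integrable_of_continuous
          (((continuous_sphMonomial i).comp continuous_fst).mul
            ((continuous_sphMonomial i).comp continuous_snd)) _
    · exact (integral_prod _ (integrable_of_continuous (continuous_logKernel hc hα) _)).symm
  · rw [norm_mul, norm_pow, Real.norm_of_nonneg (logCoeff_pos hc hα hαc m).le]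
    exact mul_le_of_le_one_right (logCoeff_pos hc hα hαc m).le
      (pow_le_one₀ (norm_nonneg _) (abs_inner_le_one p.1 p.2))

/-- If two measures have the same kernel mean, then the energy of their difference vanishes. As
this energy is a series of nonnegative terms, all moments of the two measures agree. -/
theorem integral_sphMonomial_eq (hc : 0 < c) (hα : 0 < α) (hαc : α < 1 / (2 + c))
    (μ ν : Measure (Sph n)) [IsFiniteMeasure μ] [IsFiniteMeasure ν]
    (h : ∀ x, ∫ y, logKernel n c α x y ∂μ = ∫ y, logKernel n c α x y ∂ν)
    {m : ℕ} (i : Fin m → Fin (n + 1)) :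
    ∫ x, sphMonomial i x ∂μ = ∫ x, sphMonomial i x ∂ν := by
  have E := hasSum_integral_integral_logKernel (n := n) hc hα hαc
  -- The energy of `μ - ν`, by bilinearity.
  have hsum := ((E μ μ).sub (E μ ν)).sub ((E ν μ).sub (E ν ν))
  simp only [h, sub_self] at hsum
  have hterm (m : ℕ) : logCoeff c α m * ∑ i : Fin m → Fin (n + 1),
        (∫ x, sphMonomial i x ∂μ) * ∫ y, sphMonomial i y ∂μ
      - logCoeff c α m * ∑ i : Fin m → Fin (n + 1),
        (∫ x, sphMonomial i x ∂μ) * ∫ y, sphMonomial i y ∂ν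
      - (logCoeff c α m * ∑ i : Fin m → Fin (n + 1),
        (∫ x, sphMonomial i x ∂ν) * ∫ y, sphMonomial i y ∂μ
      - logCoeff c α m * ∑ i : Fin m → Fin (n + 1),
        (∫ x, sphMonomial i x ∂ν) * ∫ y, sphMonomial i y ∂ν)
      = logCoeff c α m * ∑ i : Fin m → Fin (n + 1),
        ((∫ x, sphMonomial i x ∂μ) - ∫ x, sphMonomial i x ∂ν) ^ 2 := by
    rw [← mul_sub, ← mul_sub, ← mul_sub, ← Finset.sum_sub_distrib, ← Finset.sum_sub_distrib,
      ← Finset.sum_sub_distrib]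
    congr 1
    exact Finset.sum_congr rfl fun i _ => by ring
  simp only [hterm] at hsum
  have hnonneg (m : ℕ) : 0 ≤ ∑ i : Fin m → Fin (n + 1),
      ((∫ x, sphMonomial i x ∂μ) - ∫ x, sphMonomial i x ∂ν) ^ 2 :=
    Finset.sum_nonneg fun i _ => sq_nonneg _
  have hzero := congrFun ((hasSum_zero_iff_of_nonneg fun m =>
    mul_nonneg (logCoeff_pos hc hα hαc m).le (hnonneg m)).1 hsum) m
  have hzero' := (mul_eq_zero.1 hzero).resolve_left (logCoeff_pos hc hα hαc m).ne'
  have hi := (Finset.sum_eq_zero_iff_of_nonneg fun i _ => sq_nonneg _).1 hzero' i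
    (Finset.mem_univ i)
  exact sub_eq_zero.1 (pow_eq_zero_iff two_ne_zero |>.1 hi)

/-- The coordinate functions on the sphere. -/
noncomputable def sphCoord (j : Fin (n + 1)) : C(Sph n, ℝ) :=
  ⟨fun x => (x : EuclideanSpace ℝ (Fin (n + 1))) j, by fun_prop⟩

theorem exists_sphMonomial_of_mem_closure {f : C(Sph n, ℝ)}
    (hf : f ∈ Submonoid.closure (Set.range (sphCoord (n := n)))) :
    ∃ (m : ℕ) (i : Fin m → Fin (n + 1)), ⇑f = sphMonomial i := by
  induction hf using Submonoid.closure_induction_left with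
  | one => exact ⟨0, Fin.elim0, by funext x; simp [sphMonomial]⟩
  | mul_left g hg f _ ih =>
    obtain ⟨j, rfl⟩ := hg
    obtain ⟨m, i, hi⟩ := ih
    refine ⟨m + 1, Fin.cons j i, ?_⟩
    funext x
    simp [sphMonomial, Fin.prod_univ_succ, hi, sphCoord]

theorem separatesPoints_adjoin_sphCoord :
    (Algebra.adjoin ℝ (Set.range (sphCoord (n := n)))).SeparatesPoints := by
  intro x y hxy
  have : ∃ j, (x : EuclideanSpace ℝ (Fin (n + 1))) j
      ≠ (y : EuclideanSpace ℝ (Fin (n + 1))) j := by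
    by_contra! h
    exact hxy (Subtype.ext (PiLp.ext h))
  obtain ⟨j, hj⟩ := this
  exact ⟨_, ⟨sphCoord j, Algebra.subset_adjoin ⟨j, rfl⟩, rfl⟩, hj⟩

/-- By the Stone–Weierstrass theorem, a finite measure on the sphere is determined by its
moments. -/
theorem measure_eq_of_integral_sphMonomial_eq (μ ν : Measure (Sph n)) [IsFiniteMeasure μ]
    [IsFiniteMeasure ν]
    (h : ∀ (m : ℕ) (i : Fin m → Fin (n + 1)),
      ∫ x, sphMonomial i x ∂μ = ∫ x, sphMonomial i x ∂ν) : μ = ν := by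
  have hadj : ∀ f ∈ Algebra.adjoin ℝ (Set.range (sphCoord (n := n))),
      ∫ x, f x ∂μ = ∫ x, f x ∂ν := by
    intro f hf
    rw [← Subalgebra.mem_toSubmodule, Algebra.adjoin_eq_span] at hf
    induction hf using Submodule.span_induction with
    | mem f hf =>
      obtain ⟨m, i, hi⟩ := exists_sphMonomial_of_mem_closure hf
      rw [hi, h]
    | zero => simp
    | add f g _ _ hf hg =>
      simp only [ContinuousMap.add_apply]
      rw [integral_add (integrable_of_continuous f.continuous μ)
        (integrable_of_continuous g.continuous μ),
        integral_add (integrable_of_continuous f.continuous ν)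
        (integrable_of_continuous g.continuous ν), hf, hg]
    | smul r f _ hf =>
      simp only [ContinuousMap.smul_apply, integral_smul, hf]
  -- The polynomial functions, as bounded continuous functions.
  let A : StarSubalgebra ℝ (BoundedContinuousFunction (Sph n) ℝ) :=
    { (Algebra.adjoin ℝ (Set.range (sphCoord (n := n)))).comap
        (BoundedContinuousFunction.toContinuousMapₐ ℝ) with
      star_mem' := fun {f} hf => by
        have : star f = f := by
          ext x
          simp
        rwa [this] }
  refine ext_of_forall_mem_subalgebra_integral_eq_of_pseudoEMetric_complete_countable (A := A)
    ?_ fun g hg => hadj _ hg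
  intro x y hxy
  obtain ⟨_, ⟨f, hf, rfl⟩, hne⟩ := separatesPoints_adjoin_sphCoord hxy
  exact ⟨_, ⟨f, ⟨BoundedContinuousFunction.mkOfCompact f, hf, rfl⟩, rfl⟩, hne⟩

theorem isCharacteristic_logKernel (hc : 0 < c) (hα : 0 < α) (hαc : α < 1 / (2 + c)) :
    IsCharacteristic (logKernel n c α) := by
  have hpsd := posSemidef_kernelMatrix_logKernel (n := n) hc hα hαc
  have : Fact (kernelMatrix (logKernel n c α)).PosSemidef := ⟨hpsd⟩
  have hint (μ : ProbabilityMeasure (Sph n)) :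
      Integrable (feature (logKernel n c α)) (μ : Measure (Sph n)) :=
    integrable_feature _ (continuous_logKernel hc hα) _
  refine ⟨hpsd, hint, fun μ ν h => ?_⟩
  refine Subtype.ext (measure_eq_of_integral_sphMonomial_eq (μ : Measure (Sph n)) ν fun m i =>
    integral_sphMonomial_eq hc hα hαc (μ : Measure (Sph n)) ν (fun x => ?_) i)
  rw [← meanEmbedding_apply _ μ (hint μ), ← meanEmbedding_apply _ ν (hint ν), h]

end SphericalLog

theorem mainTheorem12 (n : ℕ) (c α : ℝ) (hc : 0 < c) (hα : 0 < α) (hαc : α < 1 / (2 + c)) :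
    -- the kernel takes strictly positive values
    (∀ x y : SphericalLog.Sph n, 0 < SphericalLog.logKernel n c α x y) ∧
    -- it is smooth on the product of the sphere with itself
    ContMDiff ((𝓡 n).prod (𝓡 n)) 𝓘(ℝ) ∞
      (fun p : SphericalLog.Sph n × SphericalLog.Sph n =>
        SphericalLog.logKernel n c α p.1 p.2) ∧
    -- its Riemannian gradient in the first variable is bounded by `1 / c`
    (∀ x y : SphericalLog.Sph n,
      SphericalLog.roundNorm x
        (SphericalLog.sphereGrad (fun z => SphericalLog.logKernel n c α z y) x) ≤ 1 / c) ∧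
    -- it is characteristic
    SphericalLog.IsCharacteristic (SphericalLog.logKernel n c α) ∧
    -- it is a power series in `x · y` with positive coefficients
    (∃ a : ℕ → ℝ, (∀ m, 0 < a m) ∧
      a 0 = -Real.log (α * (1 + c)) ∧ (∀ m, 1 ≤ m → a m = 1 / (m * (1 + c) ^ m)) ∧
      ∀ x y : SphericalLog.Sph n,
        HasSum (fun m => a m * ⟪(x : EuclideanSpace ℝ (Fin (n + 1))), y⟫_ℝ ^ m)
          (SphericalLog.logKernel n c α x y)) := by
  exact ⟨SphericalLog.logKernel_pos hc hα hαc, SphericalLog.contMDiff_logKernel hc hα,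
    SphericalLog.roundNorm_sphereGrad_logKernel_le hc hα,
    SphericalLog.isCharacteristic_logKernel hc hα hαc,
    SphericalLog.logCoeff c α, SphericalLog.logCoeff_pos hc hα hαc, rfl,
    fun m hm => by
      obtain ⟨k, rfl⟩ := Nat.exists_eq_succ_of_ne_zero (Nat.one_le_iff_ne_zero.1 hm)
      rfl,
    SphericalLog.hasSum_logKernel hc hα⟩
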